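/- Call a topological space \emph{orderable} if its topology is the order topology of some linear order on it, i.e. the topology generated by the open intervals (including unbounded ones). Call a topological space $X$ \emph{regularly locally ordered} if every point of $X$ has a neighbourhood whose closure in $X$, with the subspace topology, is orderable. Every second-countable, regularly locally ordered space $X$ is homeomorphic to a disjoint union (topological sum) of at most countably many copies of the unit circle and a subspace of the real line: there are a (finite or infinite, possibly empty) countable index set $I$ and a (possibly empty) subset $S\subseteq\mathbb{R}$ such that $$X\;\cong\;\Bigl(\bigsqcup_{i\in I} S^1\Bigr)\sqcup S .$$ -/

import Mathlib

open Topology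

/-- A topological space is orderable if its topology is the order topology (generated by open
intervals, including unbounded ones) of some linear order on it. -/
def OrderableSpace (X : Type*) [TopologicalSpace X] : Prop :=
  ∃ _ : LinearOrder X, OrderTopology X

/-- A topological space is regularly locally ordered if each point has a neighbourhood whose
closure, with the subspace topology, is orderable. -/
def RegularlyLocallyOrdered (X : Type*) [TopologicalSpace X] : Prop :=
  ∀ x : X, ∃ U ∈ 𝓝 x, OrderableSpace (closure U)

/-!
Every point `q` has a clopen neighbourhood that is a circle or embeds in `ℝ`. Around `q` there is
a closed set `C` embedding in `ℝ` and containing `q` in its interior. If the image of `C` has gaps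
arbitrarily close to `q` on both sides, cutting `C` at two of them gives a clopen set. Otherwise
`q` is in the closure of an open arc, hence of a maximal one, by Zorn's lemma. If the two ends of
the maximal arc accumulate at a common point, they close up to a clopen circle. If not, then each
end either runs off to infinity or converges to a point, beyond which maximality forces a gap, so
that adding a piece of a chart at each end yields a clopen set embedding in `ℝ`.

By second countability `X` is then a countable disjoint union of clopen sets of these two kinds,
and those of the second kind can be placed in the disjoint intervals `(n, n + 1)`.
-/

open Set Filter

theorem exists_isOpenEmbedding_range_eq_Ioo {a b : ℝ} (hab : a < b) :
    ∃ k : ℝ → ℝ, IsOpenEmbedding k ∧ range k = Ioo a b := by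
  let φ : OpenPartialHomeomorph ℝ ℝ := OpenPartialHomeomorph.univBall ((a + b) / 2) ((b - a) / 2)
  have hs : φ.source = univ := OpenPartialHomeomorph.univBall_source _ _
  refine ⟨φ, φ.isOpenEmbedding hs, ?_⟩
  rw [← image_univ, ← hs, φ.image_source_eq_target,
    OpenPartialHomeomorph.univBall_target _ (by linarith), Real.ball_eq_Ioo]
  ring_nf

theorem nonempty_homeomorph_real_of_isOpen {U : Set ℝ} (hU : IsOpen U) (hc : IsConnected U) :
    Nonempty (U ≃ₜ ℝ) := by
  obtain ⟨k, hk, hkr⟩ := exists_isOpenEmbedding_range_eq_Ioo (neg_lt_self (zero_lt_one' ℝ))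
  have hkU : k '' U ⊆ Ioo (-1) 1 := hkr ▸ image_subset_range k U
  have hbelow : BddBelow (k '' U) := bddBelow_Ioo.mono hkU
  have habove : BddAbove (k '' U) := bddAbove_Ioo.mono hkU
  have hkc : IsConnected (k '' U) := hc.image k hk.continuous.continuousOn
  have himage : k '' U = Ioo (sInf (k '' U)) (sSup (k '' U)) := by
    refine Subset.antisymm ?_ (hkc.Ioo_csInf_csSup_subset hbelow habove)
    rw [← interior_Icc]
    exact (hk.isOpenMap U hU).subset_interior_iff.2 (subset_Icc_csInf_csSup hbelow habove)
  obtain ⟨j, hj, hjr⟩ :=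
    exists_isOpenEmbedding_range_eq_Ioo (nonempty_Ioo.1 (himage ▸ hkc.nonempty))
  exact ⟨(hk.isEmbedding.homeomorphImage U).trans <|
    (Homeomorph.setCongr (himage.trans hjr.symm)).trans hj.isEmbedding.toHomeomorph.symm⟩

section OrderTopology

variable {Y Z : Type*} [TopologicalSpace Y] [LinearOrder Y] [OrderTopology Y]

theorem continuous_iSup_Iic [ConditionallyCompleteLinearOrder Z] [DenselyOrdered Z]
    [TopologicalSpace Z] [OrderTopology Z] {h : Y → Z} (hc : Continuous h)
    (hb : BddAbove (range h)) :
    Continuous fun x : Y => ⨆ y : Iic x, h y := by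
  have bdd (x : Y) : BddAbove (range fun y : Iic x => h y) :=
    hb.mono (range_comp_subset_range Subtype.val h)
  have le {x y : Y} (hyx : y ≤ x) : h y ≤ ⨆ z : Iic x, h z := le_ciSup (bdd x) ⟨y, hyx⟩
  refine continuous_iff_continuousAt.2 fun x => tendsto_order.2 ⟨fun a ha => ?_, fun a ha => ?_⟩
  · obtain ⟨⟨y, hyx⟩, hay⟩ := exists_lt_of_lt_ciSup ha
    rcases (mem_Iic.1 hyx).lt_or_eq with hyx | rfl
    · filter_upwards [Ioi_mem_nhds hyx] with z hz
      exact hay.trans_le (le (mem_Ioi.1 hz).le)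
    · filter_upwards [hc.continuousAt.eventually (lt_mem_nhds hay)] with z hz
      exact hz.trans_le (le le_rfl)
  · obtain ⟨c, hxc, hca⟩ := exists_between ha
    have hlt : ∀ᶠ y in 𝓝 x, h y < c :=
      hc.continuousAt.eventually (gt_mem_nhds ((le le_rfl).trans_lt hxc))
    have hIcc : ∀ᶠ z in 𝓝 x, Icc x z ⊆ {y | h y < c} :=
      (tendsto_const_nhds.Icc tendsto_id).eventually (eventually_smallSets_subset.2 hlt)
    filter_upwards [hIcc] with z hz
    refine lt_of_le_of_lt (ciSup_le fun ⟨y, hyz⟩ => ?_) hca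
    rcases le_total y x with hyx | hxy
    · exact (le hyx).trans hxc.le
    · exact (hz ⟨hxy, hyz⟩ : h y < c).le

theorem isEmbedding_of_strictMono [TopologicalSpace Z] [LinearOrder Z] [OrderClosedTopology Z]
    {g : Y → Z} (hm : StrictMono g) (hc : Continuous g) : IsEmbedding g := by
  refine ⟨⟨le_antisymm hc.le_induced ?_⟩, hm.injective⟩
  rw [OrderTopology.topology_eq_generate_intervals (α := Y)]
  refine le_generateFrom ?_
  rintro _ ⟨a, rfl | rfl⟩
  · exact ⟨Ioi (g a), isOpen_Ioi, ext fun _ => hm.lt_iff_lt⟩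
  · exact ⟨Iio (g a), isOpen_Iio, ext fun _ => hm.lt_iff_lt⟩

theorem exists_continuous_monotone_lt_of_isOpen [TopologicalSpace.MetrizableSpace Y] {V : Set Y}
    (hV : IsOpen V) :
    ∃ G : Y → ℝ, Continuous G ∧ Monotone G ∧ (∀ x, G x ∈ Icc 0 1) ∧
      ∀ x, ∀ y ∈ V, V ⊆ Ioi x → G x < G y := by
  let : MetricSpace Y := TopologicalSpace.metrizableSpaceMetric Y
  let h (y : Y) : ℝ := min 1 (Metric.infDist y Vᶜ)
  have h_le (y : Y) : h y ≤ 1 := min_le_left _ _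
  have h_nonneg (y : Y) : 0 ≤ h y := le_min zero_le_one Metric.infDist_nonneg
  have hb : BddAbove (range h) := ⟨1, forall_mem_range.2 h_le⟩
  have le {x y : Y} (hyx : y ≤ x) : h y ≤ ⨆ z : Iic x, h z :=
    le_ciSup (hb.mono (range_comp_subset_range Subtype.val h)) (⟨y, hyx⟩ : Iic x)
  refine ⟨fun x => ⨆ y : Iic x, h y,
    continuous_iSup_Iic (continuous_const.min (Metric.continuous_infDist_pt _)) hb,
    fun x y hxy => ciSup_le fun z => le (z.2.trans hxy),
    fun x => ⟨(h_nonneg x).trans (le le_rfl), ciSup_le fun y => h_le y⟩, fun x y hy hVx => ?_⟩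
  have h_x : ⨆ z : Iic x, h z ≤ 0 := ciSup_le fun z => by
    have hz : (z : Y) ∈ Vᶜ := fun hz => (hVx hz).not_ge z.2
    exact (min_le_right _ _).trans (Metric.infDist_zero_of_mem hz).le
  have h_y : 0 < h y := lt_min one_pos <|
    (hV.isClosed_compl.notMem_iff_infDist_pos ⟨x, fun hx => lt_irrefl _ (hVx hx)⟩).1 (not_not.2 hy)
  exact h_x.trans_lt (h_y.trans_le (le le_rfl))

theorem exists_strictMono_continuous_of_countable [Preorder Z] [TopologicalSpace Z] {ι : Type*}
    [Countable ι] {G : ι → Z → ℝ} (hc : ∀ i, Continuous (G i)) (hm : ∀ i, Monotone (G i))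
    (hG : ∀ i x, G i x ∈ Icc 0 1) (hlt : ∀ x y, x < y → ∃ i, G i x < G i y) :
    ∃ g : Z → ℝ, StrictMono g ∧ Continuous g := by
  let : Encodable ι := Encodable.ofCountable ι
  let w (i : ι) : ℝ := (1 / 2) ^ Encodable.encode i
  have hw (i : ι) : 0 < w i := by positivity
  have summable_w : Summable w := summable_geometric_two_encode
  have norm_le (i : ι) (x : Z) : ‖w i * G i x‖ ≤ w i := by
    rw [Real.norm_of_nonneg (mul_nonneg (hw i).le (hG i x).1)]
    exact mul_le_of_le_one_right (hw i).le (hG i x).2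
  have hs (x : Z) : Summable fun i => w i * G i x :=
    summable_w.of_norm_bounded fun i => norm_le i x
  refine ⟨fun x => ∑' i, w i * G i x, fun x y hxy => ?_,
    continuous_tsum (fun i => continuous_const.mul (hc i)) summable_w norm_le⟩
  obtain ⟨i, hi⟩ := hlt x y hxy
  exact (hs x).tsum_lt_tsum (fun j => mul_le_mul_of_nonneg_left (hm j hxy.le) (hw j).le)
    (mul_lt_mul_of_pos_left hi (hw i)) (hs y)

theorem exists_strictMono_continuous [SecondCountableTopology Y] :
    ∃ g : Y → ℝ, StrictMono g ∧ Continuous g := by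
  have hB := TopologicalSpace.isBasis_countableBasis Y
  choose G hc hm hG hlt using fun V : TopologicalSpace.countableBasis Y =>
    exists_continuous_monotone_lt_of_isOpen (hB.isOpen V.2)
  refine exists_strictMono_continuous_of_countable hc hm hG fun x y hxy => ?_
  obtain ⟨V, hV, hyV, hVx⟩ := hB.exists_subset_of_mem_open (mem_Ioi.2 hxy) isOpen_Ioi
  exact ⟨⟨V, hV⟩, hlt ⟨V, hV⟩ x y hyV hVx⟩

theorem nonempty_homeomorph_real [SecondCountableTopology Y] [ConnectedSpace Y] [NoMinOrder Y]
    [NoMaxOrder Y] : Nonempty (Y ≃ₜ ℝ) := by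
  obtain ⟨g, hm, hc⟩ := exists_strictMono_continuous (Y := Y)
  have hconn : IsConnected (range g) := isConnected_range hc
  have hopen : IsOpen (range g) := isOpen_iff_mem_nhds.2 <| forall_mem_range.2 fun y => by
    obtain ⟨a, ha⟩ := exists_lt y
    obtain ⟨b, hb⟩ := exists_gt y
    exact mem_of_superset (Icc_mem_nhds (hm ha) (hm hb))
      (hconn.Icc_subset (mem_range_self a) (mem_range_self b))
  obtain ⟨φ⟩ := nonempty_homeomorph_real_of_isOpen hopen hconn
  exact ⟨(isEmbedding_of_strictMono hm hc).toHomeomorph.trans φ⟩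

end OrderTopology

/-- `g` restricts to a topological embedding of the subspace `A`; nothing is asked of `g` off
`A`. -/
def IsEmbeddingOn {X Y : Type*} [TopologicalSpace X] [TopologicalSpace Y] (g : X → Y)
    (A : Set X) : Prop :=
  IsEmbedding (A.domRestrict g)

namespace IsEmbeddingOn

variable {X Y Z : Type*} [TopologicalSpace X] [TopologicalSpace Y] [TopologicalSpace Z]
  {g g₁ g₂ : X → Y} {A B : Set X}

theorem iff_injOn_and_nhdsWithin_eq :
    IsEmbeddingOn g A ↔ InjOn g A ∧ ∀ x ∈ A, 𝓝[A] x = comap g (𝓝 (g x)) ⊓ 𝓟 A := by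
  rw [IsEmbeddingOn, isEmbedding_iff, ← injOn_iff_injective, and_comm, isInducing_iff_nhds,
    Subtype.forall]
  refine and_congr_right fun _ => forall₂_congr fun x hx => ⟨fun h => ?_, fun h => ?_⟩
  · rw [← map_nhds_subtype_val ⟨x, hx⟩, h, domRestrict_eq, ← comap_comap, map_comap,
      Subtype.range_val]
    rfl
  · rw [nhds_subtype_eq_comap_nhdsWithin, h, comap_inf, comap_principal, comap_comap,
      Subtype.coe_preimage_self, principal_univ, inf_top_eq]
    rfl

theorem injOn (h : IsEmbeddingOn g A) : InjOn g A := (iff_injOn_and_nhdsWithin_eq.1 h).1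

theorem nhdsWithin_eq (h : IsEmbeddingOn g A) {x : X} (hx : x ∈ A) :
    𝓝[A] x = comap g (𝓝 (g x)) ⊓ 𝓟 A :=
  (iff_injOn_and_nhdsWithin_eq.1 h).2 x hx

theorem empty : IsEmbeddingOn g ∅ := .of_subsingleton _

theorem mono (h : IsEmbeddingOn g B) (hAB : A ⊆ B) : IsEmbeddingOn g A :=
  show IsEmbedding (B.domRestrict g ∘ inclusion hAB) from IsEmbedding.comp h (.inclusion hAB)

theorem congr (h : IsEmbeddingOn g₁ A) (hg : EqOn g₁ g₂ A) : IsEmbeddingOn g₂ A := by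
  rwa [IsEmbeddingOn, ← domRestrict_eq_domRestrict_iff.2 hg]

theorem comp {k : Y → Z} (hk : IsEmbedding k) (h : IsEmbeddingOn g A) : IsEmbeddingOn (k ∘ g) A :=
  show IsEmbedding (k ∘ A.domRestrict g) from IsEmbedding.comp hk h

theorem exists_inter_preimage_ball_subset {Y : Type*} [PseudoMetricSpace Y] {g : X → Y}
    (h : IsEmbeddingOn g A) {x : X} (hx : x ∈ A) {N : Set X} (hN : N ∈ 𝓝 x) :
    ∃ ε > 0, A ∩ g ⁻¹' Metric.ball (g x) ε ⊆ N := by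
  have hb := ((Metric.nhds_basis_ball (x := g x)).comap g).inf_principal A
  obtain ⟨ε, hε, hsub⟩ := hb.mem_iff.1 (h.nhdsWithin_eq hx ▸ mem_nhdsWithin_of_mem_nhds hN)
  exact ⟨ε, hε, inter_comm A _ ▸ hsub⟩

theorem insert [T1Space X] [LinearOrder Y] [OrderTopology Y] {p : X} (hA : IsEmbeddingOn g A)
    (hlt : ∀ x ∈ A, g x < g p) (hp : Tendsto g (𝓝[A] p) (𝓝 (g p)))
    (hN : ∀ N ∈ 𝓝 p, ∃ a < g p, A ∩ g ⁻¹' Ioi a ⊆ N) : IsEmbeddingOn g (insert p A) := by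
  have hpA : p ∉ A := fun h => lt_irrefl _ (hlt p h)
  refine iff_injOn_and_nhdsWithin_eq.2 ⟨(injOn_insert hpA).2 ⟨hA.injOn, ?_⟩, ?_⟩
  · rintro ⟨x, hx, hxp⟩
    exact (hlt x hx).ne hxp
  rintro x (rfl | hx)
  · have hpure : Tendsto g (pure x) (𝓝 (g x)) :=
      (tendsto_pure_pure g x).mono_right (pure_le_nhds _)
    refine le_antisymm (le_inf (nhdsWithin_insert x A ▸ sup_le hpure.le_comap hp.le_comap)
      inf_le_right) ?_
    refine le_inf (fun N hN' => ?_) inf_le_right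
    obtain ⟨a, ha, hsub⟩ := hN N hN'
    refine mem_inf_of_inter (preimage_mem_comap (Ioi_mem_nhds ha)) (mem_principal_self _) ?_
    rintro y ⟨hy, rfl | hyA⟩
    exacts [mem_of_mem_nhds hN', hsub ⟨hyA, hy⟩]
  · have hxp : x ≠ p := fun h => hpA (h ▸ hx)
    have hdisj : comap g (𝓝 (g x)) ⊓ 𝓟 {p} = ⊥ := disjoint_iff.1 <| disjoint_principal_right.2
      ⟨Iio (g p), Iio_mem_nhds (hlt x hx), fun y hy hyp =>
        (mem_singleton_iff.1 hyp ▸ hy : g p < g p).false⟩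
    rw [nhdsWithin_insert_of_ne hxp, hA.nhdsWithin_eq hx, ← singleton_union, ← sup_principal,
      inf_sup_left, hdisj, bot_sup_eq]

theorem range_of_comp {Z : Type*} [TopologicalSpace Z] {e : Z → X} (he : IsEmbedding e)
    (hge : IsEmbedding (g ∘ e)) : IsEmbeddingOn g (range e) := by
  have : (range e).domRestrict g = g ∘ e ∘ he.toHomeomorph.symm :=
    funext fun x => congrArg g (congrArg Subtype.val (he.toHomeomorph.apply_symm_apply x)).symm
  rw [IsEmbeddingOn, this]
  exact hge.comp he.toHomeomorph.symm.isEmbedding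

theorem union [LinearOrder Y] [OrderTopology Y] {p : X} (hA : IsEmbeddingOn g A)
    (hB : IsEmbeddingOn g B) (hBc : IsClosed B) (hpA : p ∈ A) (hAB : closure A ∩ B = {p})
    (hle : ∀ x ∈ A, g x ≤ g p) (hge : ∀ x ∈ B, g p ≤ g x) : IsEmbeddingOn g (A ∪ B) := by
  have hpB : p ∈ B := inter_subset_right (hAB.ge rfl)
  have hlt : ∀ x ∈ A, x ≠ p → g x < g p := fun x hx hne =>
    (hle x hx).lt_of_ne fun h => hne (hA.injOn hx hpA h)
  have hgt : ∀ x ∈ B, x ≠ p → g p < g x := fun x hx hne =>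
    (hge x hx).lt_of_ne fun h => hne (hB.injOn hpB hx h).symm
  refine iff_injOn_and_nhdsWithin_eq.2 ⟨?_, fun x hx => ?_⟩
  · have hdisj : ∀ x ∈ A, ∀ y ∈ B, g x = g y → x = y := fun x hx y hy hxy => by
      have hxp : g x = g p := le_antisymm (hle x hx) (hxy ▸ hge y hy)
      rw [hA.injOn hx hpA hxp, hB.injOn hy hpB (hxy.symm.trans hxp)]
    rintro x (hx | hx) y (hy | hy) hxy
    exacts [hA.injOn hx hy hxy, hdisj x hx y hy hxy, (hdisj y hy x hx hxy.symm).symm,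
      hB.injOn hx hy hxy]
  · rw [nhdsWithin_union, ← sup_principal, inf_sup_left]
    congr 1
    · by_cases hxA : x ∈ A
      · exact hA.nhdsWithin_eq hxA
      have hxp : x ≠ p := fun h => hxA (h ▸ hpA)
      have hxB : x ∈ B := hx.resolve_left hxA
      have hxcl : x ∉ closure A := fun h => hxp (hAB.le ⟨h, hxB⟩)
      rw [notMem_closure_iff_nhdsWithin_eq_bot.1 hxcl, eq_comm, ← disjoint_iff,
        disjoint_principal_right]
      exact ⟨Ioi (g p), Ioi_mem_nhds (hgt x hxB hxp), fun y hy hyA => (hle y hyA).not_gt hy⟩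
    · by_cases hxB : x ∈ B
      · exact hB.nhdsWithin_eq hxB
      have hxp : x ≠ p := fun h => hxB (h ▸ hpB)
      have hxA : x ∈ A := hx.resolve_right hxB
      rw [notMem_closure_iff_nhdsWithin_eq_bot.1 (hBc.closure_eq.symm ▸ hxB), eq_comm,
        ← disjoint_iff, disjoint_principal_right]
      exact ⟨Iio (g p), Iio_mem_nhds (hlt x hxA hxp), fun y hy hyB => (hge y hyB).not_gt hy⟩

theorem exists_union [LinearOrder Y] [OrderTopology Y] {p : X} (hA : IsEmbeddingOn g₁ A)
    (hB : IsEmbeddingOn g₂ B) (hBc : IsClosed B) (hpA : p ∈ A) (hAB : closure A ∩ B = {p})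
    (hp : g₁ p = g₂ p) (hle : ∀ x ∈ A, g₁ x ≤ g₁ p) (hge : ∀ x ∈ B, g₂ p ≤ g₂ x) :
    ∃ g : X → Y, EqOn g g₁ A ∧ EqOn g g₂ B ∧ IsEmbeddingOn g (A ∪ B) := by
  classical
  have h₁ : EqOn (A.piecewise g₁ g₂) g₁ A := piecewise_eqOn A g₁ g₂
  have h₂ : EqOn (A.piecewise g₁ g₂) g₂ B := fun x hx => by
    by_cases hxA : x ∈ A
    · obtain rfl : x = p := hAB.le ⟨subset_closure hxA, hx⟩
      rw [h₁ hxA, hp]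
    · exact piecewise_eq_of_notMem A g₁ g₂ hxA
  have hp₁ := h₁ hpA
  refine ⟨_, h₁, h₂, (hA.congr h₁.symm).union (hB.congr h₂.symm) hBc hpA hAB ?_ ?_⟩
  · exact fun x hx => by rw [h₁ hx, hp₁]; exact hle x hx
  · exact fun x hx => by rw [h₂ hx, hp₁, hp]; exact hge x hx

end IsEmbeddingOn

section Charts

variable {X : Type*} [TopologicalSpace X]

theorem OrderableSpace.t3Space (hX : OrderableSpace X) : T3Space X := by
  obtain ⟨_, _⟩ := hX
  infer_instance

theorem OrderableSpace.exists_isEmbedding [SecondCountableTopology X] (hX : OrderableSpace X) :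
    ∃ g : X → ℝ, IsEmbedding g := by
  obtain ⟨_, _⟩ := hX
  obtain ⟨g, hm, hc⟩ := exists_strictMono_continuous (Y := X)
  exact ⟨g, isEmbedding_of_strictMono hm hc⟩

theorem RegularlyLocallyOrdered.regularSpace (hX : RegularlyLocallyOrdered X) :
    RegularSpace X := by
  refine RegularSpace.of_exists_mem_nhds_isClosed_subset fun x s hs => ?_
  obtain ⟨U, hU, hord⟩ := hX x
  have := hord.t3Space
  have hC : closure U ∈ 𝓝 x := mem_of_superset hU subset_closure
  have hs' : (Subtype.val : closure U → X) ⁻¹' s ∈ 𝓝 ⟨x, mem_of_mem_nhds hC⟩ :=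
    continuous_subtype_val.continuousAt.preimage_mem_nhds hs
  obtain ⟨t, ht, htc, hts⟩ := exists_mem_nhds_isClosed_subset hs'
  refine ⟨Subtype.val '' t, ?_, isClosed_closure.isClosedEmbedding_subtypeVal.isClosedMap t htc,
    image_subset_iff.2 hts⟩
  rw [← map_nhds_subtype_coe_eq_nhds (mem_of_mem_nhds hC) hC]
  exact image_mem_map ht

theorem RegularlyLocallyOrdered.t3Space (hX : RegularlyLocallyOrdered X) : T3Space X := by
  have := hX.regularSpace
  have : T0Space X := ⟨fun x y hxy => by
    obtain ⟨U, hU, hord⟩ := hX x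
    have := hord.t3Space
    have hy : U ∈ 𝓝 y := hxy.nhds_eq ▸ hU
    have hxy' : Inseparable (⟨x, subset_closure (mem_of_mem_nhds hU)⟩ : closure U)
        ⟨y, subset_closure (mem_of_mem_nhds hy)⟩ := IsInducing.subtypeVal.inseparable_iff.1 hxy
    exact congrArg Subtype.val hxy'.eq⟩
  exact {}

/-- A linear picture of a space near a point: `f` embeds the closed neighbourhood `C` of `q` into
the line, with `q` at `0`, and no boundary point of `C` has its value within `r` of `0`. The
function is defined on the whole space so that it can be evaluated along paths leaving `C`. -/
structure IsChart (f : X → ℝ) (C : Set X) (q : X) (r : ℝ) : Prop where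
  continuous : Continuous f
  isClosed : IsClosed C
  emb : IsEmbeddingOn f C
  mem : q ∈ C
  map_eq : f q = 0
  pos : 0 < r
  subset_interior : C ∩ f ⁻¹' Ioo (-r) r ⊆ interior C

theorem RegularlyLocallyOrdered.exists_isChart [SecondCountableTopology X]
    (hX : RegularlyLocallyOrdered X) (q : X) : ∃ f C r, IsChart f C q r := by
  have := hX.t3Space
  obtain ⟨U, hU, hord⟩ := hX q
  obtain ⟨g, hg⟩ := hord.exists_isEmbedding
  obtain ⟨f, hf⟩ :=
    ContinuousMap.exists_restrict_eq isClosed_closure (⟨g, hg.continuous⟩ : C(closure U, ℝ))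
  have hq : q ∈ closure U := subset_closure (mem_of_mem_nhds hU)
  have hfU : IsEmbeddingOn f (closure U) := by
    rwa [IsEmbeddingOn, ← show g = (closure U).domRestrict f from congrArg DFunLike.coe hf.symm]
  obtain ⟨r, hr, hsub⟩ := hfU.exists_inter_preimage_ball_subset hq
    (interior_mem_nhds.2 (mem_of_superset hU subset_closure))
  refine ⟨fun x => f x - f q, closure U, r, by fun_prop, isClosed_closure,
    hfU.comp (Homeomorph.subRight (f q)).isEmbedding, hq, sub_self _, hr, ?_⟩
  rintro x ⟨hxU, hx⟩
  exact hsub ⟨hxU, by simpa [Real.dist_eq, abs_lt] using hx⟩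

namespace IsChart

variable {f : X → ℝ} {C : Set X} {q : X} {r : ℝ}

theorem neg (h : IsChart f C q r) : IsChart (-f) C q r where
  continuous := h.continuous.neg
  isClosed := h.isClosed
  emb := show IsEmbeddingOn (Neg.neg ∘ f) C from h.emb.comp (Homeomorph.neg ℝ).isEmbedding
  mem := h.mem
  map_eq := by simp [h.map_eq]
  pos := h.pos
  subset_interior := fun x hx =>
    h.subset_interior ⟨hx.1, neg_lt_neg_iff.1 (by simpa using hx.2.2),
      by simpa [neg_lt] using hx.2.1⟩

theorem isOpen_inter (h : IsChart f C q r) {I : Set ℝ} (hI : IsOpen I) (hIr : I ⊆ Ioo (-r) r) :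
    IsOpen (C ∩ f ⁻¹' I) := by
  have : C ∩ f ⁻¹' I = interior C ∩ f ⁻¹' I :=
    Subset.antisymm (fun x hx => ⟨h.subset_interior ⟨hx.1, hIr hx.2⟩, hx.2⟩)
      (inter_subset_inter_left _ interior_subset)
  exact this ▸ isOpen_interior.inter (hI.preimage h.continuous)

theorem isClosed_inter (h : IsChart f C q r) {I : Set ℝ} (hI : IsClosed I) :
    IsClosed (C ∩ f ⁻¹' I) := h.isClosed.inter (hI.preimage h.continuous)

theorem mem_nhds (h : IsChart f C q r) : C ∈ 𝓝 q :=
  mem_interior_iff_mem_nhds.1 <| h.subset_interior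
    ⟨h.mem, by rw [mem_preimage, h.map_eq]; exact ⟨neg_lt_zero.2 h.pos, h.pos⟩⟩

theorem eq_of_map_eq_zero (h : IsChart f C q r) {x : X} (hx : x ∈ C) (hfx : f x = 0) : x = q :=
  h.emb.injOn hx h.mem (hfx.trans h.map_eq.symm)

theorem exists_Icc_subset (h : IsChart f C q r) {N : Set X} (hN : N ∈ 𝓝 q) :
    ∃ δ ∈ Ioo 0 r, C ∩ f ⁻¹' Icc (-δ) δ ⊆ N := by
  obtain ⟨ε, hε, hsub⟩ := h.emb.exists_inter_preimage_ball_subset h.mem hN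
  obtain ⟨δ, hδ, hδ'⟩ := exists_between (lt_min hε h.pos)
  rw [lt_min_iff] at hδ'
  refine ⟨δ, ⟨hδ, hδ'.2⟩, fun x hx => hsub ⟨hx.1, ?_⟩⟩
  rw [mem_preimage, h.map_eq, Real.ball_eq_Ioo, zero_sub, zero_add]
  exact ⟨(neg_lt_neg hδ'.1).trans_le hx.2.1, hx.2.2.trans_lt hδ'.1⟩

end IsChart

end Charts

section Ends

variable {X : Type*} [TopologicalSpace X] {e : ℝ → X} {q : X} {T : ℝ}

theorem mapClusterPt_comp_neg_iff :
    MapClusterPt q atTop (e ∘ Neg.neg) ↔ MapClusterPt q atBot e := by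
  rw [MapClusterPt, MapClusterPt, ← Filter.map_map, map_neg_atTop]

theorem mapClusterPt_of_mem_closure_image_Ici [T2Space X] (he : Continuous e)
    (hq : q ∈ closure (e '' Ici T)) (hqe : q ∉ e '' Ici T) : MapClusterPt q atTop e := by
  refine mapClusterPt_iff_frequently.2 fun N hN => frequently_atTop.2 fun T' => ?_
  by_contra! hT'
  have hsub : e '' Ici T ⊆ e '' Icc T T' ∪ Nᶜ := image_subset_iff.2 fun t ht =>
    (le_total t T').imp (fun h => ⟨t, ⟨ht, h⟩, rfl⟩) (hT' t)
  have hcl := closure_mono hsub hq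
  rw [closure_union, (isCompact_Icc.image he).isClosed.closure_eq, closure_compl] at hcl
  rcases hcl with ⟨t, ht, rfl⟩ | hN'
  · exact hqe ⟨t, ht.1, rfl⟩
  · exact hN' (mem_interior_iff_mem_nhds.2 hN)

theorem mapClusterPt_of_mem_closure_image_Iic [T2Space X] (he : Continuous e)
    (hq : q ∈ closure (e '' Iic T)) (hqe : q ∉ e '' Iic T) : MapClusterPt q atBot e := by
  have himg : (e ∘ Neg.neg) '' Ici (-T) = e '' Iic T := by
    rw [image_comp, image_neg_eq_neg, neg_Ici, neg_neg]
  rw [← himg] at hq hqe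
  exact mapClusterPt_comp_neg_iff.1
    (mapClusterPt_of_mem_closure_image_Ici (he.comp continuous_neg) hq hqe)

theorem closure_image_Ici [T2Space X] (he : Continuous e) (hq : Tendsto e atTop (𝓝 q)) :
    closure (e '' Ici T) = insert q (e '' Ici T) := by
  refine Subset.antisymm (fun x hx => ?_) (insert_subset ?_ subset_closure)
  · by_cases hxe : x ∈ e '' Ici T
    · exact Or.inr hxe
    · have hcl := mapClusterPt_of_mem_closure_image_Ici he hx hxe
      have : (𝓝 x ⊓ 𝓝 q).NeBot := ClusterPt.mono hcl hq
      exact Or.inl (eq_of_nhds_neBot this)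
  · exact mem_closure_of_tendsto hq ((eventually_ge_atTop T).mono fun t ht => ⟨t, ht, rfl⟩)

theorem notMem_range_of_mapClusterPt (he : IsOpenEmbedding e) (hq : MapClusterPt q atTop e) :
    q ∉ range e := by
  rintro ⟨s, rfl⟩
  have hfreq := hq.frequently (he.image_mem_nhds.2 (Iio_mem_nhds (lt_add_one s)))
  obtain ⟨t, ht, hst⟩ := (hfreq.and_eventually (eventually_ge_atTop (s + 1))).exists
  exact ((he.injective.mem_set_image).1 ht).not_ge hst

theorem eventually_mem_of_frequently_mem {D K : Set X} (he : Continuous e) (hD : IsOpen D)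
    (hK : IsClosed K) (hDK : D ⊆ K) (hev : ∀ᶠ t in atTop, e t ∉ K \ D)
    (hfr : ∃ᶠ t in atTop, e t ∈ D) : ∀ᶠ t in atTop, e t ∈ D := by
  obtain ⟨T, hT⟩ := eventually_atTop.1 hev
  obtain ⟨t, ht, htT⟩ := (hfr.and_eventually (eventually_ge_atTop T)).exists
  have hsub : Ici T ⊆ e ⁻¹' D := isPreconnected_Ici.subset_left_of_subset_union
    (hD.preimage he) (hK.isOpen_compl.preimage he)
    (disjoint_left.2 fun t ht ht' => ht' (hDK ht))
    (fun t ht => or_iff_not_imp_left.2 fun htD htK => hT t ht ⟨htK, htD⟩) ⟨t, htT, ht⟩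
  exact (eventually_ge_atTop T).mono hsub

namespace IsChart

variable {f : X → ℝ} {C : Set X} {r : ℝ}

theorem tendsto_of_mapClusterPt (h : IsChart f C q r) (he : Continuous e)
    (hi : Function.Injective e) (hq : MapClusterPt q atTop e) : Tendsto e atTop (𝓝 q) := by
  have hval (c : ℝ) : ∀ᶠ t in atTop, ¬(e t ∈ C ∧ f (e t) = c) := by
    by_cases hc : ∃ t₀, e t₀ ∈ C ∧ f (e t₀) = c
    · obtain ⟨t₀, ht₀, rfl⟩ := hc
      filter_upwards [eventually_gt_atTop t₀] with t ht htc
      exact ht.ne' (hi (h.emb.injOn htc.1 ht₀ htc.2))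
    · exact Eventually.of_forall fun t ht => hc ⟨t, ht⟩
  intro N hN
  obtain ⟨δ, ⟨hδ, hδr⟩, hsub⟩ := h.exists_Icc_subset hN
  have hD : IsOpen (C ∩ f ⁻¹' Ioo (-δ) δ) :=
    h.isOpen_inter isOpen_Ioo (Ioo_subset_Ioo (neg_le_neg hδr.le) hδr.le)
  have hDK : C ∩ f ⁻¹' Ioo (-δ) δ ⊆ C ∩ f ⁻¹' Icc (-δ) δ :=
    inter_subset_inter_right _ (preimage_mono Ioo_subset_Icc_self)
  have hqD : q ∈ C ∩ f ⁻¹' Ioo (-δ) δ :=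
    ⟨h.mem, by rw [mem_preimage, h.map_eq]; exact ⟨neg_lt_zero.2 hδ, hδ⟩⟩
  refine (eventually_mem_of_frequently_mem he hD (h.isClosed_inter isClosed_Icc) hDK ?_
    (hq.frequently (hD.mem_nhds hqD))).mono fun t ht => hsub (hDK ht)
  filter_upwards [hval (-δ), hval δ] with t h₁ h₂ ⟨⟨htC, ht⟩, htD⟩
  exact htD ⟨htC, ht.1.lt_of_ne fun heq => h₁ ⟨htC, heq.symm⟩,
    ht.2.lt_of_ne fun heq => h₂ ⟨htC, heq⟩⟩

theorem eventually_neg_or_pos (h : IsChart f C q r) (he : Continuous e)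
    (hq : Tendsto e atTop (𝓝 q)) (hqe : q ∉ range e) :
    (∀ᶠ t in atTop, e t ∈ C ∩ f ⁻¹' Iio 0) ∨ ∀ᶠ t in atTop, e t ∈ C ∩ f ⁻¹' Ioi 0 := by
  obtain ⟨T, hT⟩ := eventually_atTop.1 (hq h.mem_nhds)
  have hne : ∀ t ∈ Ici T, f (e t) ∈ Iio 0 ∪ Ioi 0 := fun t ht =>
    lt_or_gt_of_ne fun h0 => hqe ⟨t, h.eq_of_map_eq_zero (hT t ht) h0⟩
  have hfe : Continuous (f ∘ e) := h.continuous.comp he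
  exact (isPreconnected_Ici.subset_or_subset (isOpen_Iio.preimage hfe) (isOpen_Ioi.preimage hfe)
    (disjoint_left.2 fun t => lt_asymm) hne).imp
    (fun hs => (eventually_ge_atTop T).mono fun t ht => ⟨hT t ht, hs ht⟩)
    (fun hs => (eventually_ge_atTop T).mono fun t ht => ⟨hT t ht, hs ht⟩)

theorem tendsto_map (h : IsChart f C q r) (hq : Tendsto e atTop (𝓝 q)) :
    Tendsto (f ∘ e) atTop (𝓝 0) :=
  h.map_eq ▸ (h.continuous.tendsto q).comp hq

theorem inter_preimage_Ico_subset_image (h : IsChart f C q r) (he : Continuous e)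
    (hq : Tendsto e atTop (𝓝 q)) (hT : ∀ t ≥ T, e t ∈ C) :
    C ∩ f ⁻¹' Ico (f (e T)) 0 ⊆ e '' Ici T := by
  rintro x ⟨hxC, hx⟩
  obtain ⟨s, hxs, hs⟩ := (((h.tendsto_map hq).eventually (lt_mem_nhds hx.2)).and
    (eventually_ge_atTop T)).exists
  obtain ⟨t, ht, htx⟩ := intermediate_value_Icc hs (h.continuous.comp he).continuousOn
    (show f x ∈ Icc ((f ∘ e) T) ((f ∘ e) s) from ⟨hx.1, le_of_lt hxs⟩)
  exact ⟨t, ht.1, h.emb.injOn (hT t ht.1) hxC htx⟩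

theorem exists_inter_preimage_Ioo_subset_image (h : IsChart f C q r) (he : Continuous e)
    (hq : Tendsto e atTop (𝓝 q)) (hneg : ∀ᶠ t in atTop, e t ∈ C ∩ f ⁻¹' Iio 0) (T : ℝ) :
    ∃ δ > 0, C ∩ f ⁻¹' Ioo (-δ) 0 ⊆ e '' Ici T := by
  obtain ⟨S, hS⟩ := eventually_atTop.1 hneg
  have hSmax := hS (max S T) (le_max_left S T)
  refine ⟨-f (e (max S T)), neg_pos.2 hSmax.2, ?_⟩
  rw [neg_neg]
  exact (inter_subset_inter_right C (preimage_mono Ioo_subset_Ico_self)).trans <|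
    (h.inter_preimage_Ico_subset_image he hq fun t ht => (hS t (le_of_max_le_left ht)).1).trans
      (image_mono (Ici_subset_Ici.2 (le_max_right S T)))

theorem not_neg_of_neg (h : IsChart f C q r) (he : Continuous e) (hi : Function.Injective e)
    (htop : Tendsto e atTop (𝓝 q)) (hbot : Tendsto e atBot (𝓝 q))
    (hneg : ∀ᶠ t in atTop, e t ∈ C ∩ f ⁻¹' Iio 0) :
    ¬∀ᶠ t in atTop, (e ∘ Neg.neg) t ∈ C ∩ f ⁻¹' Iio 0 := by
  intro hneg'
  obtain ⟨δ, hδ, hsub⟩ := h.exists_inter_preimage_Ioo_subset_image he htop hneg 1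
  have hlt := (h.tendsto_map (tendsto_comp_neg_atTop_iff.2 hbot)).eventually
    (lt_mem_nhds (neg_lt_zero.2 hδ))
  obtain ⟨t, ⟨ht, htδ⟩, ht0⟩ := ((hneg'.and hlt).and (eventually_ge_atTop 0)).exists
  have : 1 ≤ -t := hi.mem_set_image.1 (hsub ⟨ht.1, htδ, ht.2⟩)
  linarith

theorem insert_range_mem_nhds_of_neg_of_pos (h : IsChart f C q r) (he : Continuous e)
    (htop : Tendsto e atTop (𝓝 q)) (hbot : Tendsto e atBot (𝓝 q))
    (hneg : ∀ᶠ t in atTop, e t ∈ C ∩ f ⁻¹' Iio 0)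
    (hpos : ∀ᶠ t in atTop, (e ∘ Neg.neg) t ∈ C ∩ f ⁻¹' Ioi 0) : insert q (range e) ∈ 𝓝 q := by
  have hpos' : ∀ᶠ t in atTop, (e ∘ Neg.neg) t ∈ C ∩ (-f) ⁻¹' Iio 0 :=
    hpos.mono fun t ht => ⟨ht.1, (neg_lt_zero (α := ℝ)).2 ht.2⟩
  obtain ⟨δ, hδ, hsub⟩ := h.exists_inter_preimage_Ioo_subset_image he htop hneg 0
  obtain ⟨δ', hδ', hsub'⟩ := h.neg.exists_inter_preimage_Ioo_subset_image
    (he.comp continuous_neg) (tendsto_comp_neg_atTop_iff.2 hbot) hpos' 0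
  have hf : ∀ᶠ x in 𝓝 q, f x ∈ Ioo (-δ) δ' := h.continuous.continuousAt.eventually
    (h.map_eq ▸ Ioo_mem_nhds (neg_lt_zero.2 hδ) hδ')
  filter_upwards [h.mem_nhds, hf] with x hxC hx
  rcases lt_trichotomy (f x) 0 with h0 | h0 | h0
  · exact Or.inr (image_subset_range _ _ (hsub ⟨hxC, hx.1, h0⟩))
  · exact Or.inl (h.eq_of_map_eq_zero hxC h0)
  · exact Or.inr (range_comp_subset_range _ _ (image_subset_range _ _
      (hsub' ⟨hxC, neg_lt_neg hx.2, neg_lt_zero.2 h0⟩)))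

theorem insert_range_mem_nhds (h : IsChart f C q r) (he : Continuous e)
    (hi : Function.Injective e) (htop : Tendsto e atTop (𝓝 q)) (hbot : Tendsto e atBot (𝓝 q))
    (hqe : q ∉ range e) : insert q (range e) ∈ 𝓝 q := by
  wlog hneg : ∀ᶠ t in atTop, e t ∈ C ∩ f ⁻¹' Iio 0 generalizing f
  · refine this h.neg (((h.eventually_neg_or_pos he htop hqe).resolve_left hneg).mono ?_)
    exact fun t ht => ⟨ht.1, (neg_lt_zero (α := ℝ)).2 ht.2⟩
  · refine h.insert_range_mem_nhds_of_neg_of_pos he htop hbot hneg ?_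
    exact (h.eventually_neg_or_pos (he.comp continuous_neg) (tendsto_comp_neg_atTop_iff.2 hbot)
      fun hq => hqe (range_comp_subset_range _ _ hq)).resolve_left
      (h.not_neg_of_neg he hi htop hbot hneg)

end IsChart

theorem nonempty_onePoint_real_homeomorph_circle : Nonempty (OnePoint ℝ ≃ₜ Circle) := by
  have φ : OnePoint ℝ ≃ₜ Metric.sphere (0 : EuclideanSpace ℝ (Fin 2)) 1 :=
    onePointEquivSphereOfFinrankEq (by simp)
  let i := Complex.orthonormalBasisOneI.repr.symm
  refine ⟨φ.trans (i.toHomeomorph.subtype fun x => ?_)⟩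
  change x ∈ Metric.sphere 0 1 ↔ i x ∈ Metric.sphere 0 1
  rw [mem_sphere_zero_iff_norm, mem_sphere_zero_iff_norm, i.norm_map]

theorem nonempty_insert_range_homeomorph_circle [T2Space X] (he : IsEmbedding e)
    (hq : Tendsto e (cocompact ℝ) (𝓝 q)) (hqe : q ∉ range e) :
    Nonempty (↥(insert q (range e)) ≃ₜ Circle) := by
  have : CompactSpace ↥(insert q (range e)) :=
    isCompact_iff_compactSpace.1 (hq.isCompact_insert_range_of_cocompact he.continuous)
  let e' : ℝ → ↥(insert q (range e)) := codRestrict e _ fun t => Or.inr (mem_range_self t)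
  have hrange : range e' = {⟨q, mem_insert q _⟩}ᶜ := by
    ext ⟨x, hx⟩
    rw [mem_compl_singleton_iff, Ne, Subtype.mk.injEq]
    exact ⟨by rintro ⟨t, ht⟩ rfl; exact hqe ⟨t, congrArg Subtype.val ht⟩,
      fun hxq => (hx.resolve_left hxq).imp fun t ht => Subtype.ext ht⟩
  obtain ⟨φ⟩ := nonempty_onePoint_real_homeomorph_circle
  exact ⟨(OnePoint.equivOfIsEmbeddingOfRangeEq _ e' (he.codRestrict _ _) hrange).symm.trans φ⟩

theorem IsChart.isClopen_insert_range_and_homeomorph_circle [T2Space X] {f : X → ℝ} {C : Set X}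
    {r : ℝ} (h : IsChart f C q r) (he : IsOpenEmbedding e) (htop : MapClusterPt q atTop e)
    (hbot : MapClusterPt q atBot e) :
    IsClopen (insert q (range e)) ∧ Nonempty (↥(insert q (range e)) ≃ₜ Circle) := by
  have hqe := notMem_range_of_mapClusterPt he htop
  have ht := h.tendsto_of_mapClusterPt he.continuous he.injective htop
  have hb := tendsto_comp_neg_atTop_iff.1 <| h.tendsto_of_mapClusterPt
    (he.continuous.comp continuous_neg) (he.injective.comp neg_injective)
    (mapClusterPt_comp_neg_iff.2 hbot)
  have hq : Tendsto e (cocompact ℝ) (𝓝 q) := cocompact_eq_atBot_atTop (α := ℝ) ▸ hb.sup ht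
  refine ⟨⟨(hq.isCompact_insert_range_of_cocompact he.continuous).isClosed,
    isOpen_iff_mem_nhds.2 ?_⟩, nonempty_insert_range_homeomorph_circle he.isEmbedding hq hqe⟩
  rintro x (rfl | hx)
  · exact h.insert_range_mem_nhds he.continuous he.injective ht hb hqe
  · exact mem_of_superset (he.isOpen_range.mem_nhds hx) (subset_insert _ _)

end Ends

section Arcs

section Directed

variable {L ι Y : Type*} [LinearOrder L]

theorem exists_linearOrder_strictMono {e : ι → L → Y} (hi : ∀ i, Function.Injective (e i))
    (hdir : Directed (fun d d' => ∃ φ : L → L, StrictMono φ ∧ d = d' ∘ φ) e)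
    (hcov : ∀ y, ∃ i, y ∈ range (e i)) :
    ∃ _ : LinearOrder Y, ∀ i, StrictMono (e i) := by
  have triple (x y z : Y) : ∃ i a b c, e i a = x ∧ e i b = y ∧ e i c = z := by
    obtain ⟨i, a, rfl⟩ := hcov x
    obtain ⟨j, b, rfl⟩ := hcov y
    obtain ⟨k, c, rfl⟩ := hcov z
    obtain ⟨l, ⟨φ, -, hφ⟩, ⟨ψ, -, hψ⟩⟩ := hdir i j
    obtain ⟨m, ⟨χ, -, hχ⟩, ⟨ω, -, hω⟩⟩ := hdir l k
    exact ⟨m, χ (φ a), χ (ψ b), ω c, by simp [hφ, hχ], by simp [hψ, hχ], by simp [hω]⟩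
  let le (x y : Y) : Prop := ∃ i s t, e i s = x ∧ e i t = y ∧ s ≤ t
  have le_iff {i s t} : le (e i s) (e i t) ↔ s ≤ t := by
    refine ⟨?_, fun hst => ⟨i, s, t, rfl, rfl, hst⟩⟩
    rintro ⟨j, s', t', hs, ht, hst⟩
    obtain ⟨k, ⟨φ, hφ, hij⟩, ⟨ψ, hψ, hjk⟩⟩ := hdir i j
    rw [hij, hjk] at hs ht
    rw [← hφ.le_iff_le, ← hi k hs, ← hi k ht]
    exact hψ.monotone hst
  let : LinearOrder Y :=
    { le := le
      le_refl := fun x => by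
        obtain ⟨i, a, -, -, rfl, -⟩ := triple x x x
        exact le_iff.2 le_rfl
      le_trans := fun x y z hxy hyz => by
        obtain ⟨i, a, b, c, rfl, rfl, rfl⟩ := triple x y z
        exact le_iff.2 ((le_iff.1 hxy).trans (le_iff.1 hyz))
      le_antisymm := fun x y hxy hyx => by
        obtain ⟨i, a, b, -, rfl, rfl, -⟩ := triple x y y
        exact congrArg (e i) (le_antisymm (le_iff.1 hxy) (le_iff.1 hyx))
      le_total := fun x y => by
        obtain ⟨i, a, b, -, rfl, rfl, -⟩ := triple x y y
        exact (le_total a b).imp le_iff.2 le_iff.2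
      toDecidableLE := Classical.decRel _ }
  have hmono (i : ι) : Monotone (e i) := fun s t => le_iff.2
  exact ⟨this, fun i => (hmono i).strictMono_of_injective (hi i)⟩

theorem orderTopology_of_isOpenEmbedding {L : Type*} [ConditionallyCompleteLinearOrder L]
    [DenselyOrdered L] [NoMinOrder L] [NoMaxOrder L] [TopologicalSpace L] [OrderTopology L]
    [TopologicalSpace Y] [LinearOrder Y] {e : ι → L → Y}
    (he : ∀ i, IsOpenEmbedding (e i)) (hm : ∀ i, StrictMono (e i))
    (hpair : ∀ x y, ∃ i, x ∈ range (e i) ∧ y ∈ range (e i)) : OrderTopology Y := by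
  have hIoi (a : Y) : IsOpen (Ioi a) := isOpen_iff_mem_nhds.2 fun x hx => by
    obtain ⟨i, ⟨s, rfl⟩, ⟨t, rfl⟩⟩ := hpair a x
    exact mem_of_superset ((he i).image_mem_nhds.2 (Ioi_mem_nhds ((hm i).lt_iff_lt.1 hx)))
      (image_subset_iff.2 fun u hu => hm i hu)
  have hIio (a : Y) : IsOpen (Iio a) := isOpen_iff_mem_nhds.2 fun x hx => by
    obtain ⟨i, ⟨s, rfl⟩, ⟨t, rfl⟩⟩ := hpair a x
    exact mem_of_superset ((he i).image_mem_nhds.2 (Iio_mem_nhds ((hm i).lt_iff_lt.1 hx)))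
      (image_subset_iff.2 fun u hu => hm i hu)
  have : OrderClosedTopology Y := by
    refine ⟨isOpen_compl_iff.1 (isOpen_iff_mem_nhds.2 fun ⟨x, y⟩ hxy => ?_)⟩
    obtain ⟨i, ⟨s, rfl⟩, ⟨t, rfl⟩⟩ := hpair x y
    obtain ⟨m, htm, hms⟩ := exists_between ((hm i).lt_iff_lt.1 (not_le.1 hxy))
    exact mem_of_superset (prod_mem_nhds ((hIoi (e i m)).mem_nhds (hm i hms))
      ((hIio (e i m)).mem_nhds (hm i htm))) fun z hz => not_le.2 (lt_trans hz.2 hz.1)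
  refine ⟨le_antisymm (le_generateFrom ?_) (le_of_nhds_le_nhds fun x N hN => ?_)⟩
  · rintro _ ⟨a, rfl | rfl⟩
    exacts [hIoi a, hIio a]
  · obtain ⟨i, ⟨s, rfl⟩, -⟩ := hpair x x
    obtain ⟨a, b, hs, hab⟩ := mem_nhds_iff_exists_Ioo_subset.1
      ((he i).continuous.continuousAt.preimage_mem_nhds hN)
    have hIoo : Ioo (e i a) (e i b) ⊆ N := fun y hy => by
      obtain ⟨t, ht, rfl⟩ := intermediate_value_Ioo (hs.1.trans hs.2).le
        (he i).continuous.continuousOn hy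
      exact hab ht
    let := Preorder.topology Y
    have : OrderTopology Y := ⟨rfl⟩
    exact mem_of_superset (Ioo_mem_nhds (hm i hs.1) (hm i hs.2)) hIoo

theorem nonempty_homeomorph_real_of_directed [TopologicalSpace Y] [SecondCountableTopology Y]
    [Nonempty Y] {e : ι → ℝ → Y} (he : ∀ i, IsOpenEmbedding (e i))
    (hdir : Directed (fun d d' => ∃ φ : ℝ → ℝ, StrictMono φ ∧ d = d' ∘ φ) e)
    (hcov : ∀ y, ∃ i, y ∈ range (e i)) : Nonempty (Y ≃ₜ ℝ) := by
  obtain ⟨_, hm⟩ := exists_linearOrder_strictMono (fun i => (he i).injective) hdir hcov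
  have hpair (x y : Y) : ∃ i, x ∈ range (e i) ∧ y ∈ range (e i) := by
    obtain ⟨i, hx⟩ := hcov x
    obtain ⟨j, hy⟩ := hcov y
    obtain ⟨k, ⟨φ, -, hφ⟩, ψ, -, hψ⟩ := hdir i j
    exact ⟨k, range_comp_subset_range φ _ (hφ ▸ hx), range_comp_subset_range ψ _ (hψ ▸ hy)⟩
  have := orderTopology_of_isOpenEmbedding he hm hpair
  have : ConnectedSpace Y :=
    { isPreconnected_univ := isPreconnected_of_forall_pair fun x _ y _ => by
        obtain ⟨i, hx, hy⟩ := hpair x y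
        exact ⟨_, subset_univ _, hx, hy, isPreconnected_range (he i).continuous⟩
      toNonempty := ‹_› }
  have : NoMinOrder Y := ⟨fun y => by
    obtain ⟨i, s, rfl⟩ := hcov y
    exact ⟨e i (s - 1), hm i (sub_one_lt s)⟩⟩
  have : NoMaxOrder Y := ⟨fun y => by
    obtain ⟨i, s, rfl⟩ := hcov y
    exact ⟨e i (s + 1), hm i (lt_add_one s)⟩⟩
  exact nonempty_homeomorph_real

end Directed

variable {X : Type*} [TopologicalSpace X]

/-- A subset of `X` is an open arc if it is open and homeomorphic to the real line. -/
def IsOpenArc (V : Set X) : Prop :=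
  ∃ e : ℝ → X, IsOpenEmbedding e ∧ range e = V

theorem isOpenArc_of_homeomorph {V : Set X} (hV : IsOpen V) (φ : V ≃ₜ ℝ) : IsOpenArc V :=
  ⟨_, hV.isOpenEmbedding_subtypeVal.comp φ.symm.isOpenEmbedding, by
    rw [φ.symm.surjective.range_comp, Subtype.range_coe]⟩

theorem isOpenArc_of_isEmbeddingOn {W : Set X} {g : X → ℝ} (hW : IsOpen W)
    (hg : IsEmbeddingOn g W) (ho : IsOpen (g '' W)) (hc : IsConnected (g '' W)) :
    IsOpenArc W := by
  rw [← range_domRestrict] at ho hc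
  obtain ⟨φ⟩ := nonempty_homeomorph_real_of_isOpen ho hc
  exact isOpenArc_of_homeomorph hW (hg.toHomeomorph.trans φ)

theorem isOpenArc_iUnion [SecondCountableTopology X] {ι : Type*} [Nonempty ι] {e : ι → ℝ → X}
    (he : ∀ i, IsOpenEmbedding (e i))
    (hdir : Directed (fun d d' => ∃ φ : ℝ → ℝ, StrictMono φ ∧ d = d' ∘ φ) e) :
    IsOpenArc (⋃ i, range (e i)) := by
  have hU : IsOpen (⋃ i, range (e i)) := isOpen_iUnion fun i => (he i).isOpen_range
  let d (i : ι) : ℝ → ⋃ i, range (e i) :=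
    fun t => ⟨e i t, mem_iUnion_of_mem i (mem_range_self t)⟩
  have hd (i : ι) : IsOpenEmbedding (d i) :=
    .of_comp _ hU.isOpenEmbedding_subtypeVal (he i)
  have : Nonempty (⋃ i, range (e i)) := ⟨d (Classical.arbitrary ι) 0⟩
  obtain ⟨φ⟩ := nonempty_homeomorph_real_of_directed hd
    (fun i j => by
      obtain ⟨k, ⟨φ, hφ, hik⟩, ψ, hψ, hjk⟩ := hdir i j
      exact ⟨k, ⟨φ, hφ, funext fun t => Subtype.ext (congrFun hik t)⟩,
        ψ, hψ, funext fun t => Subtype.ext (congrFun hjk t)⟩)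
    (fun ⟨y, hy⟩ => by
      obtain ⟨i, t, rfl⟩ := mem_iUnion.1 hy
      exact ⟨i, t, rfl⟩)
  exact isOpenArc_of_homeomorph hU φ

theorem IsOpenArc.exists_isOpenEmbedding_eq {V : Set X} {p p' : X} (hV : IsOpenArc V)
    (hp : p ∈ V) (hp' : p' ∈ V) (hne : p ≠ p') :
    ∃ e : ℝ → X, IsOpenEmbedding e ∧ range e = V ∧ e 0 = p ∧ e 1 = p' := by
  obtain ⟨e, he, rfl⟩ := hV
  obtain ⟨a, rfl⟩ := hp
  obtain ⟨b, rfl⟩ := hp'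
  have hab : b - a ≠ 0 := sub_ne_zero.2 fun h => hne (congrArg e h.symm)
  let φ : ℝ ≃ₜ ℝ := (Homeomorph.mulLeft₀ (b - a) hab).trans (Homeomorph.addLeft a)
  exact ⟨e ∘ φ, he.comp φ.isOpenEmbedding, φ.surjective.range_comp e, by simp [φ], by simp [φ]⟩

theorem exists_strictMono_eq_comp {d e : ℝ → X} (hd : IsOpenEmbedding d) (he : IsOpenEmbedding e)
    (hde : range d ⊆ range e) {a b : ℝ} (hab : a < b) (ha : d a = e a) (hb : d b = e b) :
    ∃ φ : ℝ → ℝ, StrictMono φ ∧ d = e ∘ φ := by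
  choose φ hφ using fun t => hde (mem_range_self t)
  have hcomp : e ∘ φ = d := funext hφ
  have hφc : Continuous φ := by rw [he.continuous_iff, hcomp]; exact hd.continuous
  have hφi : Function.Injective φ := .of_comp (f := e) (by rw [hcomp]; exact hd.injective)
  have hφa : φ a = a := he.injective ((hφ a).trans ha)
  have hφb : φ b = b := he.injective ((hφ b).trans hb)
  refine ⟨φ, (hφc.strictMono_of_inj hφi).resolve_right fun hanti => ?_, hcomp.symm⟩
  have := hanti hab
  rw [hφa, hφb] at this
  exact lt_asymm hab this

/-- Fixing two points of the arc orients all larger arcs consistently. -/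
theorem IsOpenArc.exists_maximal [SecondCountableTopology X] {V : Set X} (hV : IsOpenArc V) :
    ∃ M, V ⊆ M ∧ Maximal IsOpenArc M := by
  obtain ⟨e₀, he₀, hV₀⟩ := id hV
  have hne : e₀ 0 ≠ e₀ 1 := he₀.injective.ne zero_ne_one
  have hmem (t : ℝ) : e₀ t ∈ V := hV₀ ▸ mem_range_self t
  suffices h : ∀ c ⊆ {W | IsOpenArc W ∧ V ⊆ W}, IsChain (· ⊆ ·) c → c.Nonempty →
      ∃ W ∈ {W | IsOpenArc W ∧ V ⊆ W}, ∀ s ∈ c, s ⊆ W by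
    obtain ⟨M, hVM, hM⟩ := zorn_subset_nonempty _ h V ⟨hV, subset_rfl⟩
    exact ⟨M, hVM, hM.1.1, fun W hW hMW => hM.2 ⟨hW, hVM.trans hMW⟩ hMW⟩
  intro c hc hchain hcne
  choose e he hre h0 h1 using fun W : c => (hc W.2).1.exists_isOpenEmbedding_eq
    ((hc W.2).2 (hmem 0)) ((hc W.2).2 (hmem 1)) hne
  have : Nonempty c := hcne.to_subtype
  have hc_eq : ⋃₀ c = ⋃ W, range (e W) := by simp only [hre, sUnion_eq_iUnion]
  refine ⟨⋃₀ c, ⟨hc_eq ▸ isOpenArc_iUnion he fun W W' => ?_, ?_⟩, fun W => subset_sUnion_of_mem⟩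
  · obtain ⟨W'', h, h'⟩ := hchain.directed W W'
    have trans (U : c) (hU : (U : Set X) ⊆ W'') : ∃ φ, StrictMono φ ∧ e U = e W'' ∘ φ :=
      exists_strictMono_eq_comp (he U) (he W'') (by rwa [hre, hre]) zero_lt_one
        ((h0 U).trans (h0 W'').symm) ((h1 U).trans (h1 W'').symm)
    exact ⟨W'', trans W h, trans W' h'⟩
  · obtain ⟨W, hW⟩ := hcne
    exact (hc hW).2.trans (subset_sUnion_of_mem hW)

end Arcs

section Caps

variable {X : Type*} [TopologicalSpace X] {e : ℝ → X} {f g : X → ℝ} {q : X} {r η b : ℝ}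
  {C F K : Set X}

/-- `g` embeds the union of the arc `e` and the set `F` into the line, with the arc parametrising
`(-π/2, π/2)` by `arctan` and `F` lying below it. The upper end of the arc corresponds to `π/2`. -/
structure IsArcCoordinate (e : ℝ → X) (F : Set X) (g : X → ℝ) : Prop where
  emb : IsEmbeddingOn g (range e ∪ F)
  map_eq : ∀ t, g (e t) = Real.arctan t
  le_of_mem : ∀ x ∈ F, g x ≤ -(Real.pi / 2)

theorem exists_isArcCoordinate (he : IsEmbedding e) : ∃ g, IsArcCoordinate e ∅ g := by
  have hge : (Real.arctan ∘ Function.invFun e) ∘ e = Real.arctan := funext fun t =>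
    congrArg Real.arctan (Function.leftInverse_invFun he.injective t)
  have harctan : IsEmbedding Real.arctan :=
    Real.arctan_strictMono.isEmbedding_of_ordConnected (Real.range_arctan ▸ ordConnected_Ioo)
  refine ⟨Real.arctan ∘ Function.invFun e, ?_, congrFun hge, fun x hx => hx.elim⟩
  rw [union_empty]
  exact .range_of_comp he (by rwa [hge])

namespace IsArcCoordinate

theorem neg (hg : IsEmbeddingOn g (range e ∪ K)) (hge : ∀ t, g (e t) = Real.arctan t)
    (hK : ∀ x ∈ K, Real.pi / 2 ≤ g x) : IsArcCoordinate (e ∘ Neg.neg) K (-g) where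
  emb := by
    rw [neg_surjective.range_comp]
    exact show IsEmbeddingOn (Neg.neg ∘ g) _ from hg.comp (Homeomorph.neg ℝ).isEmbedding
  map_eq t := by simp [hge, Real.arctan_neg]
  le_of_mem x hx := neg_le_neg (hK x hx)

theorem lt_pi_div_two (hg : IsArcCoordinate e F g) {x : X} (hx : x ∈ range e ∪ F) :
    g x < Real.pi / 2 := by
  rcases hx with ⟨t, rfl⟩ | hx
  · exact hg.map_eq t ▸ Real.arctan_lt_pi_div_two t
  · exact (hg.le_of_mem _ hx).trans_lt (neg_lt_self Real.pi_div_two_pos)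

theorem update_insert [T2Space X] [DecidableEq X] (hg : IsArcCoordinate e F g)
    (he : IsOpenEmbedding e) (hF : IsClosed F) (hqF : q ∉ F) (hq : Tendsto e atTop (𝓝 q))
    (hbot : ¬MapClusterPt q atBot e) :
    IsEmbeddingOn (Function.update g q (Real.pi / 2)) (insert q (range e ∪ F)) := by
  have hqe := notMem_range_of_mapClusterPt he hq.mapClusterPt
  have hqA : q ∉ range e ∪ F := fun h => h.elim hqe hqF
  have heq : EqOn g (Function.update g q (Real.pi / 2)) (range e ∪ F) := fun x hx =>
    (Function.update_of_ne (ne_of_mem_of_not_mem hx hqA) _ _).symm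
  have hnear (T : ℝ) : ∀ᶠ x in 𝓝[range e ∪ F] q, ∃ t > T, e t = x := by
    have hqT : q ∉ closure (e '' Iic T) := fun h => hbot <|
      mapClusterPt_of_mem_closure_image_Iic he.continuous h
        fun h' => hqe (image_subset_range _ _ h')
    filter_upwards [self_mem_nhdsWithin,
      mem_nhdsWithin_of_mem_nhds (hF.isOpen_compl.mem_nhds hqF),
      mem_nhdsWithin_of_mem_nhds (isClosed_closure.isOpen_compl.mem_nhds hqT)]
    rintro _ (⟨t, rfl⟩ | hx) hxF hxT
    · exact ⟨t, not_le.1 fun h => hxT (subset_closure ⟨t, h, rfl⟩), rfl⟩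
    · exact absurd hx hxF
  refine (hg.emb.congr heq).insert ?_ ?_ ?_ <;> rw [Function.update_self]
  · exact fun x hx => heq hx ▸ hg.lt_pi_div_two hx
  · refine Tendsto.congr' (heq.eventuallyEq_of_mem self_mem_nhdsWithin)
      (tendsto_order.2 ⟨fun a ha => ?_, fun a ha => ?_⟩)
    · obtain ⟨T, hT⟩ := ((Real.tendsto_arctan_atTop.mono_right nhdsWithin_le_nhds).eventually
        (lt_mem_nhds ha)).exists
      filter_upwards [hnear T]
      rintro _ ⟨t, ht, rfl⟩
      exact hT.trans (hg.map_eq t ▸ Real.arctan_strictMono ht)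
    · exact eventually_mem_nhdsWithin.mono fun x hx => (hg.lt_pi_div_two hx).trans ha
  · intro N hN
    obtain ⟨T, hT⟩ := eventually_atTop.1 (hq hN)
    refine ⟨Real.arctan T, Real.arctan_lt_pi_div_two T, fun x ⟨hx, hxT⟩ => ?_⟩
    rw [mem_preimage, ← heq hx] at hxT
    rcases hx with ⟨t, rfl⟩ | hxF
    · exact hT t (Real.arctan_lt_arctan_iff.1 (hg.map_eq t ▸ hxT)).le
    · exact absurd (hxT.trans_le (hg.le_of_mem x hxF)) (Real.neg_pi_div_two_lt_arctan T).not_gt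

end IsArcCoordinate

namespace IsChart

theorem isOpen_range_union (h : IsChart f C q r) (he : IsOpenEmbedding e)
    (hq : Tendsto e atTop (𝓝 q)) (hneg : ∀ᶠ t in atTop, e t ∈ C ∩ f ⁻¹' Iio 0)
    (hbr : b ≤ r) : IsOpen (range e ∪ C ∩ f ⁻¹' Ico 0 b) := by
  obtain ⟨δ, hδ, hsub⟩ := h.exists_inter_preimage_Ioo_subset_image he.continuous hq hneg 0
  have hD : IsOpen (C ∩ f ⁻¹' Ioo (-min δ r) b) := h.isOpen_inter isOpen_Ioo
    (Ioo_subset_Ioo (neg_le_neg (min_le_right δ r)) hbr)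
  convert he.isOpen_range.union hD using 1
  refine Subset.antisymm (union_subset_union_right _ ?_) (union_subset subset_union_left ?_)
  · exact fun x hx => ⟨hx.1, (neg_lt_zero.2 (lt_min hδ h.pos)).trans_le hx.2.1, hx.2.2⟩
  · rintro x ⟨hxC, hx⟩
    rcases lt_or_ge (f x) 0 with h0 | h0
    · exact Or.inl (image_subset_range _ _ (hsub
        ⟨hxC, (neg_le_neg (min_le_left δ r)).trans_lt hx.1, h0⟩))
    · exact Or.inr ⟨hxC, h0, hx.2⟩

end IsChart

theorem exists_isChart_closure_range_inter [SecondCountableTopology X]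
    (hX : RegularlyLocallyOrdered X) (he : IsOpenEmbedding e) (htop : MapClusterPt q atTop e)
    (hbot : ¬MapClusterPt q atBot e) (hF : IsClosed F) (hqF : q ∉ F) :
    ∃ f C r, IsChart f C q r ∧ (∀ᶠ t in atTop, e t ∈ C ∩ f ⁻¹' Iio 0) ∧ ∃ η ∈ Ioo 0 r,
      closure (range e) ∩ (C ∩ f ⁻¹' Icc 0 η) = {q} ∧ Disjoint F (C ∩ f ⁻¹' Icc 0 η) := by
  have := hX.t3Space
  have hqe := notMem_range_of_mapClusterPt he htop
  obtain ⟨f, C, r, h⟩ := hX.exists_isChart q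
  have hq := h.tendsto_of_mapClusterPt he.continuous he.injective htop
  wlog hneg : ∀ᶠ t in atTop, e t ∈ C ∩ f ⁻¹' Iio 0 generalizing f
  · refine this _ h.neg (((h.eventually_neg_or_pos he.continuous hq hqe).resolve_left hneg).mono ?_)
    exact fun t ht => ⟨ht.1, (neg_lt_zero (α := ℝ)).2 ht.2⟩
  obtain ⟨T, hT⟩ := eventually_atTop.1 hneg
  have hqT : q ∉ closure (e '' Iic T) := fun hc => hbot <|
    mapClusterPt_of_mem_closure_image_Iic he.continuous hc fun h' => hqe (image_subset_range _ _ h')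
  obtain ⟨η, hη, hsub⟩ := h.exists_Icc_subset
    ((hF.union isClosed_closure).isOpen_compl.mem_nhds fun hc => hc.elim hqF hqT)
  have hP : C ∩ f ⁻¹' Icc 0 η ⊆ (F ∪ closure (e '' Iic T))ᶜ :=
    (inter_subset_inter_right C (preimage_mono
      (Icc_subset_Icc_left (neg_nonpos.2 hη.1.le)))).trans hsub
  refine ⟨f, C, r, h, hneg, η, hη, Subset.antisymm ?_ ?_,
    disjoint_left.2 fun x hxF hx => hP hx (Or.inl hxF)⟩
  · rintro x ⟨hxe, hx⟩
    rw [← image_univ, ← Iic_union_Ici (a := T), image_union, closure_union] at hxe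
    have hle : closure (e '' Ici T) ⊆ f ⁻¹' Iic 0 :=
      closure_minimal (image_subset_iff.2 fun t ht => (show f (e t) < 0 from (hT t ht).2).le)
        (isClosed_Iic.preimage h.continuous)
    exact h.eq_of_map_eq_zero hx.1 (le_antisymm
      (hle (hxe.resolve_left fun hxT => hP hx (Or.inr hxT))) hx.2.1)
  · rintro _ rfl
    refine ⟨mem_closure_of_tendsto hq (Eventually.of_forall mem_range_self), h.mem, ?_⟩
    rw [mem_preimage, h.map_eq]
    exact ⟨le_rfl, hη.1.le⟩

theorem IsArcCoordinate.exists_union [T2Space X] (hg : IsArcCoordinate e F g)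
    (he : IsOpenEmbedding e) (hF : IsClosed F) (hqF : q ∉ F) (hq : Tendsto e atTop (𝓝 q))
    (hbot : ¬MapClusterPt q atBot e) (h : IsChart f C q r)
    (hcl : closure (range e) ∩ (C ∩ f ⁻¹' Icc 0 η) = {q})
    (hdisj : Disjoint F (C ∩ f ⁻¹' Icc 0 η)) :
    ∃ g' : X → ℝ, IsEmbeddingOn g' (range e ∪ F ∪ C ∩ f ⁻¹' Icc 0 η) ∧ EqOn g' g (range e) ∧
      ∀ x ∈ C ∩ f ⁻¹' Icc 0 η, g' x = Real.pi / 2 + f x := by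
  classical
  have hqA : q ∉ range e ∪ F := fun hqA =>
    hqA.elim (notMem_range_of_mapClusterPt he hq.mapClusterPt) hqF
  have heq : ∀ x ∈ range e ∪ F, Function.update g q (Real.pi / 2) x = g x := fun x hx =>
    Function.update_of_ne (ne_of_mem_of_not_mem hx hqA) _ _
  have hclA : closure (insert q (range e ∪ F)) ∩ (C ∩ f ⁻¹' Icc 0 η) = {q} := by
    rw [← singleton_union, closure_union, closure_singleton, singleton_union, closure_union,
      hF.closure_eq, insert_inter_of_mem (hcl.ge rfl).2,
      union_inter_distrib_right, hcl, hdisj.inter_eq, union_empty, pair_eq_singleton]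
  have hP : IsEmbeddingOn (fun x => Real.pi / 2 + f x) (C ∩ f ⁻¹' Icc 0 η) :=
    (h.emb.mono inter_subset_left).comp (Homeomorph.addLeft (Real.pi / 2)).isEmbedding
  have hle : ∀ x ∈ insert q (range e ∪ F), Function.update g q (Real.pi / 2) x ≤
      Function.update g q (Real.pi / 2) q := by
    rw [Function.update_self]
    rintro x (rfl | hx)
    · rw [Function.update_self]
    · exact heq x hx ▸ (hg.lt_pi_div_two hx).le
  have hge : ∀ x ∈ C ∩ f ⁻¹' Icc 0 η, Real.pi / 2 + f q ≤ Real.pi / 2 + f x := fun x hx => by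
    simpa only [h.map_eq, add_zero, le_add_iff_nonneg_right] using hx.2.1
  obtain ⟨g', hA, hP', hg'⟩ := (hg.update_insert he hF hqF hq hbot).exists_union hP
    (h.isClosed_inter isClosed_Icc) (mem_insert q _) hclA
    (by rw [Function.update_self, h.map_eq, add_zero]) hle hge
  exact ⟨g', hg'.mono (union_subset_union_left _ (subset_insert _ _)),
    fun x hx => (hA (Or.inr (Or.inl hx))).trans (heq x (Or.inl hx)), hP'⟩

theorem IsChart.exists_notMem_image_of_maximal [T2Space X] (h : IsChart f C q r)
    (he : IsOpenEmbedding e) (hmax : Maximal IsOpenArc (range e)) (hq : Tendsto e atTop (𝓝 q))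
    (hbot : ¬MapClusterPt q atBot e) (hneg : ∀ᶠ t in atTop, e t ∈ C ∩ f ⁻¹' Iio 0)
    (hη : η ∈ Ioo 0 r) (hcl : closure (range e) ∩ (C ∩ f ⁻¹' Icc 0 η) = {q}) :
    ∃ b ∈ Ioo 0 η, b ∉ f '' C := by
  by_contra! hfull
  obtain ⟨g, hg⟩ := exists_isArcCoordinate he.isEmbedding
  obtain ⟨g', hemb, hg'e, hg'C⟩ :=
    hg.exists_union he isClosed_empty (notMem_empty q) hq hbot h hcl (empty_disjoint _)
  have hsub : range e ∪ C ∩ f ⁻¹' Ico 0 η ⊆ range e ∪ ∅ ∪ C ∩ f ⁻¹' Icc 0 η :=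
    union_subset_union subset_union_left
      (inter_subset_inter_right C (preimage_mono Ico_subset_Icc_self))
  have hqW : q ∈ range e ∪ C ∩ f ⁻¹' Ico 0 η :=
    Or.inr ⟨h.mem, by rw [mem_preimage, h.map_eq]; exact ⟨le_rfl, hη.1⟩⟩
  have himg_e : g' '' range e = Ioo (-(Real.pi / 2)) (Real.pi / 2) := by
    rw [hg'e.image_eq, ← range_comp, show g ∘ e = Real.arctan from funext hg.map_eq,
      Real.range_arctan]
  have himg_C : g' '' (C ∩ f ⁻¹' Ico 0 η) = Ico (Real.pi / 2) (Real.pi / 2 + η) := by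
    have hIco : Ico 0 η ⊆ f '' C := fun y hy => hy.1.eq_or_lt.elim
      (fun h0 => ⟨q, h.mem, h.map_eq.trans h0⟩) (fun h0 => hfull y ⟨h0, hy.2⟩)
    rw [image_congr fun x hx => hg'C x ⟨hx.1, Ico_subset_Icc_self hx.2⟩,
      ← image_image (fun y => Real.pi / 2 + y) f, image_inter_preimage, inter_eq_right.2 hIco,
      image_const_add_Ico, add_zero]
  have himg : g' '' (range e ∪ C ∩ f ⁻¹' Ico 0 η) =
      Ioo (-(Real.pi / 2)) (Real.pi / 2 + η) := by
    rw [image_union, himg_e, himg_C, Ioo_union_Ico_eq_Ioo (neg_lt_self Real.pi_div_two_pos)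
      (le_add_of_nonneg_right hη.1.le)]
  have harc : IsOpenArc (range e ∪ C ∩ f ⁻¹' Ico 0 η) :=
    isOpenArc_of_isEmbeddingOn (h.isOpen_range_union he hq hneg hη.2.le) (hemb.mono hsub)
      (himg ▸ isOpen_Ioo) ⟨⟨g' q, mem_image_of_mem g' hqW⟩, himg ▸ isPreconnected_Ioo⟩
  exact notMem_range_of_mapClusterPt he hq.mapClusterPt (hmax.2 harc subset_union_left hqW)

/-- Maximality of the arc forces a gap beyond its upper end, and the piece of a chart up to the gap
closes the arc up without spoiling openness. -/
theorem IsArcCoordinate.exists_cap [SecondCountableTopology X] (hX : RegularlyLocallyOrdered X)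
    (hg : IsArcCoordinate e F g) (he : IsOpenEmbedding e) (hmax : Maximal IsOpenArc (range e))
    (hends : ∀ q, MapClusterPt q atTop e → ¬MapClusterPt q atBot e) (hF : IsClosed F)
    (hFtop : ∀ q ∈ F, ¬MapClusterPt q atTop e) :
    ∃ K g', IsClosed K ∧ IsOpen (range e ∪ K) ∧ closure (e '' Ici 0) ⊆ range e ∪ K ∧
      (∀ x ∈ K, x ∈ closure (range e) → MapClusterPt x atTop e) ∧
      IsEmbeddingOn g' (range e ∪ F ∪ K) ∧ (∀ t, g' (e t) = Real.arctan t) ∧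
      ∀ x ∈ K, Real.pi / 2 ≤ g' x := by
  have := hX.t3Space
  by_cases htop : ∃ q, MapClusterPt q atTop e
  · obtain ⟨q, hq⟩ := htop
    obtain ⟨f, C, r, h, hneg, η, hη, hcl, hdisj⟩ := exists_isChart_closure_range_inter hX he hq
      (hends q hq) hF fun hqF => hFtop q hqF hq
    have hlim := h.tendsto_of_mapClusterPt he.continuous he.injective hq
    obtain ⟨b, hb, hbC⟩ :=
      h.exists_notMem_image_of_maximal he hmax hlim (hends q hq) hneg hη hcl
    obtain ⟨g', hemb, hg'e, hg'C⟩ :=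
      hg.exists_union he hF (fun hqF => hFtop q hqF hq) hlim (hends q hq) h hcl hdisj
    have hsub : C ∩ f ⁻¹' Icc 0 b ⊆ C ∩ f ⁻¹' Icc 0 η :=
      inter_subset_inter_right C (preimage_mono (Icc_subset_Icc_right hb.2.le))
    have hgap : C ∩ f ⁻¹' Icc 0 b = C ∩ f ⁻¹' Ico 0 b :=
      Subset.antisymm (fun x hx => ⟨hx.1, hx.2.1, hx.2.2.lt_of_ne fun hxb => hbC ⟨x, hx.1, hxb⟩⟩)
        (inter_subset_inter_right C (preimage_mono Ico_subset_Icc_self))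
    have hqK : q ∈ C ∩ f ⁻¹' Icc 0 b :=
      ⟨h.mem, by rw [mem_preimage, h.map_eq]; exact ⟨le_rfl, hb.1.le⟩⟩
    refine ⟨C ∩ f ⁻¹' Icc 0 b, g', h.isClosed_inter isClosed_Icc,
      hgap ▸ h.isOpen_range_union he hlim hneg (hb.2.trans hη.2).le, ?_, fun x hx hxe => ?_,
      hemb.mono (union_subset_union_right _ hsub),
      fun t => (hg'e (mem_range_self t)).trans (hg.map_eq t), fun x hx => ?_⟩
    · rw [closure_image_Ici he.continuous hlim]
      exact insert_subset (Or.inr hqK) ((image_subset_range _ _).trans subset_union_left)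
    · obtain rfl : x = q := hcl.le ⟨hxe, hsub hx⟩
      exact hq
    · rw [hg'C x (hsub hx)]
      exact le_add_of_nonneg_right hx.2.1
  · refine ⟨∅, g, isClosed_empty, ?_, fun x hx => Or.inl ?_, fun x hx => hx.elim, ?_, hg.map_eq,
      fun x hx => hx.elim⟩
    · rw [union_empty]
      exact he.isOpen_range
    · by_contra hxe
      exact htop ⟨x, mapClusterPt_of_mem_closure_image_Ici he.continuous hx fun hx' =>
        hxe (image_subset_range _ _ hx')⟩
    · rw [union_empty]
      exact hg.emb

theorem exists_isClopen_isEmbeddingOn_of_maximal [SecondCountableTopology X]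
    (hX : RegularlyLocallyOrdered X) (he : IsOpenEmbedding e)
    (hmax : Maximal IsOpenArc (range e))
    (hends : ∀ q, MapClusterPt q atTop e → ¬MapClusterPt q atBot e) :
    ∃ W, IsClopen W ∧ range e ⊆ W ∧ ∃ g : X → ℝ, IsEmbeddingOn g W := by
  have hneg : range (e ∘ Neg.neg) = range e := neg_surjective.range_comp e
  have hbot (q : X) : MapClusterPt q atBot (e ∘ Neg.neg) ↔ MapClusterPt q atTop e := by
    rw [← mapClusterPt_comp_neg_iff, Function.comp_assoc, neg_comp_neg, Function.comp_id]
  obtain ⟨g₀, hg₀⟩ := exists_isArcCoordinate he.isEmbedding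
  obtain ⟨K, g₁, hKc, hKo, hK, hKcl, hg₁, hg₁e, hg₁K⟩ :=
    hg₀.exists_cap hX he hmax hends isClosed_empty fun q hq => hq.elim
  rw [union_empty] at hg₁
  obtain ⟨K', g, hKc', hKo', hK', -, hg, -, -⟩ :=
    (IsArcCoordinate.neg hg₁ hg₁e hg₁K).exists_cap hX
      (he.comp (Homeomorph.neg ℝ).isOpenEmbedding) (hneg ▸ hmax)
      (fun q hq hq' => hends q ((hbot q).1 hq') (mapClusterPt_comp_neg_iff.1 hq)) hKc
      fun q hqK hq => by
        have hqe : q ∈ closure (range e) :=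
          hneg ▸ mem_closure_iff_clusterPt.2 (hq.clusterPt.mono (le_principal_iff.2 range_mem_map))
        exact hends q (hKcl q hqK hqe) (mapClusterPt_comp_neg_iff.1 hq)
  rw [hneg] at hKo' hK' hg
  have hcl : closure (range e) ⊆ range e ∪ K ∪ K' := by
    have hIic : (e ∘ Neg.neg) '' Ici 0 = e '' Iic 0 := by
      rw [image_comp, image_neg_eq_neg, neg_Ici, neg_zero]
    have hunion : range e = (e ∘ Neg.neg) '' Ici 0 ∪ e '' Ici 0 := by
      rw [hIic, ← image_union, Iic_union_Ici, image_univ]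
    refine (closure_mono hunion.subset).trans ?_
    rw [closure_union]
    exact union_subset (hK'.trans (union_subset_union_left _ subset_union_left))
      (hK.trans subset_union_left)
  refine ⟨range e ∪ K ∪ K', ⟨isClosed_of_closure_subset ?_, ?_⟩,
    subset_union_left.trans subset_union_left, g, hg⟩
  · rw [closure_union, closure_union, hKc.closure_eq, hKc'.closure_eq]
    exact union_subset (union_subset hcl (subset_union_right.trans subset_union_left))
      subset_union_right
  · rw [union_assoc, union_union_distrib_left]
    exact hKo.union hKo'

end Caps

section Neighborhoods

variable {X : Type*} [TopologicalSpace X] {f : X → ℝ} {q : X} {r : ℝ} {C : Set X}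

namespace IsChart

theorem exists_isOpenArc_mem_closure (h : IsChart f C q r) (hfull : Ioo 0 r ⊆ f '' C) :
    ∃ V, IsOpenArc V ∧ q ∈ closure V := by
  have himg : f '' (C ∩ f ⁻¹' Ioo 0 r) = Ioo 0 r := by
    rw [image_inter_preimage, inter_eq_right.2 hfull]
  refine ⟨C ∩ f ⁻¹' Ioo 0 r, isOpenArc_of_isEmbeddingOn
    (h.isOpen_inter isOpen_Ioo (Ioo_subset_Ioo_left (neg_nonpos.2 h.pos.le)))
    (h.emb.mono inter_subset_left) (himg.symm ▸ isOpen_Ioo)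
    (himg.symm ▸ isConnected_Ioo h.pos), ?_⟩
  refine mem_closure_iff_nhds.2 fun N hN => ?_
  obtain ⟨δ, hδ, hsub⟩ := h.exists_Icc_subset hN
  obtain ⟨x, hx, hfx⟩ := hfull hδ
  refine ⟨x, hsub ⟨hx, ?_⟩, hx, ?_⟩ <;> rw [mem_preimage, hfx]
  exacts [⟨neg_le_self hδ.1.le, le_rfl⟩, hδ]

theorem exists_isClopen_or_mem_closure (h : IsChart f C q r) :
    (∃ W, IsClopen W ∧ q ∈ W ∧ IsEmbeddingOn f W) ∨ ∃ V, IsOpenArc V ∧ q ∈ closure V := by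
  by_cases hup : Ioo 0 r ⊆ f '' C
  · exact Or.inr (h.exists_isOpenArc_mem_closure hup)
  by_cases hdown : Ioo 0 r ⊆ (-f) '' C
  · exact Or.inr (h.neg.exists_isOpenArc_mem_closure hdown)
  obtain ⟨b, hb, hbC⟩ := not_subset.1 hup
  obtain ⟨a, ha, haC⟩ := not_subset.1 hdown
  have hgap : C ∩ f ⁻¹' Ioo (-a) b = C ∩ f ⁻¹' Icc (-a) b := by
    refine Subset.antisymm (inter_subset_inter_right C (preimage_mono Ioo_subset_Icc_self)) ?_
    exact fun x hx => ⟨hx.1, hx.2.1.lt_of_ne fun hxa => haC ⟨x, hx.1, neg_eq_iff_eq_neg.2 hxa.symm⟩,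
      hx.2.2.lt_of_ne fun hxb => hbC ⟨x, hx.1, hxb⟩⟩
  refine Or.inl ⟨C ∩ f ⁻¹' Icc (-a) b, ⟨h.isClosed_inter isClosed_Icc, ?_⟩, ⟨h.mem, ?_⟩,
    h.emb.mono inter_subset_left⟩
  · exact hgap ▸ h.isOpen_inter isOpen_Ioo (Ioo_subset_Ioo (neg_le_neg ha.2.le) hb.2.le)
  · rw [mem_preimage, h.map_eq]
    exact ⟨neg_nonpos.2 ha.1.le, hb.1.le⟩

end IsChart

theorem RegularlyLocallyOrdered.exists_isClopen [SecondCountableTopology X]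
    (hX : RegularlyLocallyOrdered X) (x : X) :
    ∃ W, IsClopen W ∧ x ∈ W ∧
      ((∃ g : X → ℝ, IsEmbeddingOn g W) ∨ Nonempty (W ≃ₜ Circle)) := by
  have := hX.t3Space
  obtain ⟨f, C, r, h⟩ := hX.exists_isChart x
  rcases h.exists_isClopen_or_mem_closure with ⟨W, hW, hxW, hf⟩ | ⟨V, hV, hxV⟩
  · exact ⟨W, hW, hxW, Or.inl ⟨f, hf⟩⟩
  obtain ⟨M, hVM, hM⟩ := hV.exists_maximal
  obtain ⟨e, he, rfl⟩ := hM.1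
  have hx : x ∈ closure (range e) := closure_mono hVM hxV
  by_cases hends : ∃ q, MapClusterPt q atTop e ∧ MapClusterPt q atBot e
  · obtain ⟨q, htop, hbot⟩ := hends
    obtain ⟨f', C', r', h'⟩ := hX.exists_isChart q
    obtain ⟨hclopen, hcircle⟩ := h'.isClopen_insert_range_and_homeomorph_circle he htop hbot
    exact ⟨_, hclopen, closure_minimal (subset_insert _ _) hclopen.1 hx, Or.inr hcircle⟩
  · obtain ⟨W, hW, hsub, hg⟩ := exists_isClopen_isEmbeddingOn_of_maximal hX he hM
      fun q htop hbot => hends ⟨q, htop, hbot⟩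
    exact ⟨W, hW, closure_minimal hsub hW.1 hx, Or.inl hg⟩

end Neighborhoods

section Decomposition

theorem exists_isEmbedding_sigma {ι : Type*} [Countable ι] {Y : ι → Type*}
    [∀ i, TopologicalSpace (Y i)] (h : ∀ i, ∃ g : Y i → ℝ, IsEmbedding g) :
    ∃ g : (Σ i, Y i) → ℝ, IsEmbedding g := by
  choose g hg using h
  obtain ⟨n, hn⟩ := exists_injective_nat ι
  obtain ⟨k, hk, hkr⟩ := exists_isOpenEmbedding_range_eq_Ioo (zero_lt_one' ℝ)
  have hk01 (t : ℝ) : k t ∈ Ioo 0 1 := hkr ▸ mem_range_self t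
  let G : (Σ _ : ι, ℝ) → ℝ := fun p => n p.1 + k p.2
  have hshift (i : ι) : IsOpenEmbedding fun t => G ⟨i, t⟩ :=
    (Homeomorph.addLeft (n i : ℝ)).isOpenEmbedding.comp hk
  have hfloor (p : Σ _ : ι, ℝ) : ⌊G p⌋ = n p.1 :=
    Int.floor_eq_iff.2 ⟨le_add_of_nonneg_right (hk01 _).1.le, add_lt_add_right (hk01 _).2 _⟩
  have hinj : Function.Injective G := by
    rintro ⟨i, s⟩ ⟨j, t⟩ hst
    obtain rfl : i = j := hn (Int.ofNat_inj.1 ((hfloor ⟨i, s⟩).symm.trans (hst ▸ hfloor ⟨j, t⟩)))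
    rw [(hshift i).injective hst]
  have hG : IsOpenEmbedding G := .of_continuous_injective_isOpenMap
    (continuous_sigma fun i => (hshift i).continuous) hinj
    (isOpenMap_sigma.2 fun i => (hshift i).isOpenMap)
  exact ⟨G ∘ Sigma.map id g,
    hG.isEmbedding.comp ((isEmbedding_sigmaMap Function.injective_id).2 hg)⟩

theorem nonempty_homeomorph_sigma_sum_sigma {ι : Type*} {Y : ι → Type*}
    [∀ i, TopologicalSpace (Y i)] (p : ι → Prop) :
    Nonempty ((Σ i, Y i) ≃ₜ (Σ i : {i // p i}, Y i) ⊕ Σ i : {i // ¬p i}, Y i) := by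
  let F : (Σ i : {i // p i}, Y i) ⊕ (Σ i : {i // ¬p i}, Y i) → Σ i, Y i :=
    Sum.elim (fun x => ⟨x.1, x.2⟩) fun x => ⟨x.1, x.2⟩
  have hcont : Continuous F :=
    (continuous_sigma fun _ => continuous_sigmaMk).sumElim
      (continuous_sigma fun _ => continuous_sigmaMk)
  have hopen : IsOpenMap F := isOpenMap_sum.2
    ⟨isOpenMap_sigma.2 fun _ => isOpenMap_sigmaMk, isOpenMap_sigma.2 fun _ => isOpenMap_sigmaMk⟩
  have hinj : Function.Injective F := by
    rintro (⟨⟨i, hi⟩, x⟩ | ⟨⟨i, hi⟩, x⟩) (⟨⟨j, hj⟩, y⟩ | ⟨⟨j, hj⟩, y⟩) hxy <;> cases hxy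
    exacts [rfl, absurd hi hj, absurd hj hi, rfl]
  have hsurj : Function.Surjective F := fun ⟨i, x⟩ =>
    (em (p i)).elim (fun hi => ⟨.inl ⟨⟨i, hi⟩, x⟩, rfl⟩) fun hi => ⟨.inr ⟨⟨i, hi⟩, x⟩, rfl⟩
  exact ⟨((Equiv.ofBijective F ⟨hinj, hsurj⟩).toHomeomorphOfContinuousOpen hcont hopen).symm⟩

variable {X : Type*} [TopologicalSpace X]

theorem nonempty_homeomorph_sigma {ι : Type*} {D : ι → Set X} (hD : ∀ i, IsOpen (D i))
    (hdisj : Pairwise (Function.onFun Disjoint D)) (hU : ⋃ i, D i = univ) :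
    Nonempty (X ≃ₜ Σ i, D i) := by
  have hunique (x : X) : ∃! i, x ∈ D i := by
    obtain ⟨i, hi⟩ := mem_iUnion.1 (hU.ge (mem_univ x))
    exact ⟨i, hi, fun j hj => hdisj.eq (not_disjoint_iff.2 ⟨x, hj, hi⟩)⟩
  exact ⟨((sigmaEquiv D hunique).toHomeomorphOfContinuousOpen
    (continuous_sigma fun _ => continuous_subtype_val)
    (isOpenMap_sigma.2 fun i => (hD i).isOpenMap_subtype_val)).symm⟩

theorem exists_pairwise_disjoint_isClopen [SecondCountableTopology X] {P : Set X → Prop}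
    (h : ∀ x, ∃ W, IsClopen W ∧ x ∈ W ∧ P W) (hempty : P ∅)
    (hmono : ∀ D W, IsClopen D → D ⊆ W → P W → P D) :
    ∃ D : ℕ → Set X, (∀ n, IsClopen (D n)) ∧ Pairwise (Function.onFun Disjoint D) ∧
      ⋃ n, D n = univ ∧ ∀ n, P (D n) := by
  choose W hW hxW hP using h
  obtain ⟨s, hs, hsU⟩ := TopologicalSpace.countable_cover_nhds fun x =>
    (hW x).isOpen.mem_nhds (hxW x)
  obtain ⟨V, hV⟩ := ((hs.image W).insert ∅).exists_eq_range (insert_nonempty _ _)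
  have hVP (n : ℕ) : IsClopen (V n) ∧ P (V n) := by
    rcases hV.ge (mem_range_self n) with hn | ⟨x, -, hn⟩
    · exact hn ▸ ⟨isClopen_empty, hempty⟩
    · exact hn ▸ ⟨hW x, hP x⟩
  have hD (n : ℕ) : IsClopen (disjointed V n) :=
    disjointedRec (p := IsClopen) (fun _ i hA => hA.diff (hVP i).1) (hVP n).1
  refine ⟨disjointed V, hD, disjoint_disjointed V, ?_,
    fun n => hmono _ _ (hD n) (disjointed_subset V n) (hVP n).2⟩
  rw [iUnion_disjointed, ← sUnion_range, ← hV, sUnion_insert, empty_union, sUnion_image, hsU]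

theorem eq_empty_or_eq_of_isClopen_of_isPreconnected {D W : Set X} (hW : IsPreconnected W)
    (hD : IsClopen D) (hDW : D ⊆ W) : D = ∅ ∨ D = W :=
  D.eq_empty_or_nonempty.imp_right fun ⟨x, hx⟩ =>
    hDW.antisymm (hW.subset_isClopen hD ⟨x, hDW hx, hx⟩)

theorem RegularlyLocallyOrdered.exists_partition [SecondCountableTopology X]
    (hX : RegularlyLocallyOrdered X) :
    ∃ D : ℕ → Set X, (∀ n, IsClopen (D n)) ∧ Pairwise (Function.onFun Disjoint D) ∧
      ⋃ n, D n = univ ∧ ∀ n, (∃ g : X → ℝ, IsEmbeddingOn g (D n)) ∨ Nonempty (D n ≃ₜ Circle) := by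
  refine exists_pairwise_disjoint_isClopen hX.exists_isClopen (Or.inl ⟨0, .empty⟩) ?_
  rintro D W hD hDW (⟨g, hg⟩ | ⟨⟨φ⟩⟩)
  · exact Or.inl ⟨g, hg.mono hDW⟩
  have hW : IsPreconnected W := by
    have : PreconnectedSpace Circle :=
      Circle.exp_surjective.denseRange.preconnectedSpace Circle.exp.continuous
    exact isPreconnected_iff_preconnectedSpace.2
      (φ.symm.surjective.denseRange.preconnectedSpace φ.symm.continuous)
  rcases eq_empty_or_eq_of_isClopen_of_isPreconnected hW hD hDW with rfl | rfl
  exacts [Or.inl ⟨0, .empty⟩, Or.inr ⟨φ⟩]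

end Decomposition

theorem mainTheorem5 {X : Type*} [TopologicalSpace X] [SecondCountableTopology X]
    (hX : RegularlyLocallyOrdered X) :
    ∃ (ι : Type) (_ : Countable ι) (S : Set ℝ), Nonempty (X ≃ₜ ((Σ _ : ι, Circle) ⊕ S)) := by
  obtain ⟨D, hD, hdisj, hU, hDe⟩ := hX.exists_partition
  let p (n : ℕ) : Prop := Nonempty (D n ≃ₜ Circle)
  let φ (i : {n // p n}) : D i ≃ₜ Circle := i.2.some
  have hline (i : {n // ¬p n}) : ∃ g : D i → ℝ, IsEmbedding g :=
    let ⟨g, hg⟩ := (hDe i).resolve_right i.2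
    ⟨(D i).domRestrict g, hg⟩
  obtain ⟨g, hg⟩ := exists_isEmbedding_sigma hline
  obtain ⟨ψ⟩ := nonempty_homeomorph_sigma (fun n => (hD n).isOpen) hdisj hU
  obtain ⟨χ⟩ := nonempty_homeomorph_sigma_sum_sigma (Y := fun n => D n) p
  have hσ : IsHomeomorph
      (Sigma.map id (fun i => φ i) : (Σ i : {n // p n}, D i) → Σ _ : {n // p n}, Circle) :=
    .sigmaMap Function.bijective_id fun i => (φ i).isHomeomorph
  exact ⟨{n // p n}, inferInstance, range g,
    ⟨ψ.trans (χ.trans ((hσ.homeomorph _).sumCongr hg.toHomeomorph))⟩⟩
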